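/- For $n\ge 0$ let $S_n$ be the set of permutations of $\{1,\dots,n\}$, written as words $\pi=a_1a_2\cdots a_n$. Say that $\pi$ avoids the pattern $a\text{-}bc$ if there are no indices $i<j<n$ with $a_i<a_j<a_{j+1}$, and that $\pi$ avoids the pattern $a\text{-}cb$ if there are no indices $i<j<n$ with $a_i<a_{j+1}<a_j$. Let $\operatorname{des}\pi$ be the number of $i<n$ with $a_i>a_{i+1}$. Put $A_0(x)=1$ and, for $n\ge 1$, $$A_n(x)=\sum_{\pi} x^{1+\operatorname{des}\pi},$$ where $\pi$ runs over the permutations in $S_n$ that avoid both $a\text{-}bc$ and $a\text{-}cb$. Let $$y_n(x)=\sum_{k=0}^n\binom{n+k}{k}\binom nk\frac{k!}{2^k}x^k$$ be the $n$th Bessel polynomial. Then: (i) as formal power series in $x$ over $\mathbb{Q}[t]$, $$\sum_{n\ge 0}A_n(t)\,x^n=\sum_{n\ge 0}y_n(x)\,(xt)^n;$$ (ii) $A_0(x)=1$, $A_1(x)=x$, and for all $n\ge 0$, $$A_{n+2}(x)=x\Bigl(1+x+2x\frac{d}{dx}\Bigr)A_n(x);$$ (iii) for all $n\ge 0$, $$A_n(x)=\sum_{k=0}^n\binom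 nk\binom{n-k}{k}\frac{k!}{2^k}\,x^{n-k}.$$ -/

import Mathlib

namespace PatternAvoidance

/-- A generalised (dashed) pattern with `k` letters: a word of `k` distinct letters from a linearly
ordered alphabet (here `ℕ`, with `a = 0`, `b = 1`, `c = 2`, …), where a dash may or may not separate
two adjacent letters. `dash i` says that a dash stands after the `i`-th letter; a dash in front of
the first letter and one behind the last letter are always understood, so the value of `dash` at
the last position plays no role. -/
structure Pattern (k : ℕ) where
  letter : Fin k → ℕ
  letter_injective : Function.Injective letter
  dash : Fin k → Prop

/-- The pattern `a-bc`. -/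
def a_bc : Pattern 3 where
  letter := ![0, 1, 2]
  letter_injective := by decide
  dash := ![True, False, True]

/-- The pattern `a-cb`. -/
def a_cb : Pattern 3 where
  letter := ![0, 2, 1]
  letter_injective := by decide
  dash := ![True, False, True]

/-- The positions `e 0 < e 1 < ⋯` of the word `π(0) π(1) ⋯ π(n-1)` carry a `p`-subword: the subword
is order equivalent to the letters of `p`, and letters of `p` that are not separated by a dash sit
at adjacent positions of the word. -/
def IsOccurrence {k n : ℕ} (p : Pattern k) (π : Equiv.Perm (Fin n)) (e : Fin k → Fin n) : Prop :=
  (∀ i j : Fin k, i < j → e i < e j) ∧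
  (∀ i j : Fin k, π (e i) < π (e j) ↔ p.letter i < p.letter j) ∧
  (∀ i j : Fin k, j.val = i.val + 1 → ¬ p.dash i → (e j).val = (e i).val + 1)

/-- The permutation `π` contains no `p`-subword. -/
def Avoids {k n : ℕ} (π : Equiv.Perm (Fin n)) (p : Pattern k) : Prop :=
  ∀ e : Fin k → Fin n, ¬ IsOccurrence p π e

open Classical in
/-- The permutations in `S_n` that avoid both `a-bc` and `a-cb`. -/
noncomputable def avoiders (n : ℕ) : Finset (Equiv.Perm (Fin n)) :=
  Finset.univ.filter fun π => Avoids π a_bc ∧ Avoids π a_cb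

open Classical in
/-- The number of descents of `π`. -/
noncomputable def des {n : ℕ} (π : Equiv.Perm (Fin n)) : ℕ :=
  (Finset.univ.filter fun i : Fin n => ∃ h : i.val + 1 < n, π ⟨i.val + 1, h⟩ < π i).card

/-- The `n`-th Eulerian polynomial for `{a-bc, a-cb}`-avoiding permutations,
`A_n(x) = ∑_π x ^ (1 + des π)` for `n ≥ 1`, with the usual convention `A_0(x) = 1`. -/
noncomputable def eulerianPoly (n : ℕ) : Polynomial ℚ :=
  if n = 0 then 1 else ∑ π ∈ avoiders n, Polynomial.X ^ (1 + des π)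

/-- The `n`-th Bessel polynomial `y_n(x)`. -/
noncomputable def besselPoly (n : ℕ) : Polynomial ℚ :=
  ∑ k ∈ Finset.range (n + 1),
    Polynomial.C (((n + k).choose k : ℚ) * (n.choose k : ℚ) * ((k.factorial : ℚ) / 2 ^ k)) *
      Polynomial.X ^ k

open scoped PowerSeries.WithPiTopology in
/-- Convergence of a sum of formal power series in `x` over `ℚ[t]` to `F`: unconditional
convergence for the product topology of the discrete topology on the coefficients `ℚ[t]`. -/
def FormalHasSum (f : ℕ → PowerSeries (Polynomial ℚ)) (F : PowerSeries (Polynomial ℚ)) : Prop :=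
  letI : TopologicalSpace (Polynomial ℚ) := ⊥
  HasSum f F

end PatternAvoidance

namespace PatternAvoidance

open Polynomial

/-! Avoiding both patterns means that the smaller of any two adjacent letters lies below all letters
before the pair. For the last two letters, one must therefore be the overall minimum. If it is the
last, deleting it leaves any avoider and loses a descent; if it is the one before, the last letter
is any of n+1 values and adds no descent. This gives A_{n+2} = x A_{n+1} + (n+1) x A_n
(`eulerianPoly_add_two`). Involutions weighted by number of cycles satisfy the same recurrence,
whence the explicit formula. The differential recurrence follows through a first-order identity for
2x A_n', and the Bessel series by comparing coefficients. -/

/-- Append the value `p` at the end of the word of `σ`, relabelling the values of `σ` by the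
complement of `p`. -/
def snoc {n : ℕ} (p : Fin (n + 1)) (σ : Equiv.Perm (Fin n)) : Equiv.Perm (Fin (n + 1)) :=
  (finSuccEquivLast.trans (Equiv.optionCongr σ)).trans (finSuccEquiv' p).symm

@[simp]
theorem snoc_last {n : ℕ} (p : Fin (n + 1)) (σ : Equiv.Perm (Fin n)) :
    snoc p σ (Fin.last n) = p := by
  simp [snoc]

@[simp]
theorem snoc_castSucc {n : ℕ} (p : Fin (n + 1)) (σ : Equiv.Perm (Fin n)) (i : Fin n) :
    snoc p σ i.castSucc = p.succAbove (σ i) := by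
  simp [snoc]

theorem snoc_bijective (n : ℕ) :
    Function.Bijective fun q : Fin (n + 1) × Equiv.Perm (Fin n) => snoc q.1 q.2 := by
  rw [Fintype.bijective_iff_injective_and_card]
  refine ⟨?_, by simp [Fintype.card_perm, Nat.factorial_succ]⟩
  rintro ⟨p, σ⟩ ⟨q, τ⟩ h
  simp only at h
  have hp : p = q := by simpa using congrArg (fun π => π (Fin.last n)) h
  subst hp
  refine Prod.ext rfl (Equiv.ext fun i => ?_)
  have := congrArg (fun π => π i.castSucc) h
  simpa using this

/-! ### Avoidance and descents when a last letter is appended -/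

/-- Of any two adjacent letters one is smaller than every letter before them. -/
def AdjMin {n : ℕ} (π : Equiv.Perm (Fin n)) : Prop :=
  ∀ i j k : Fin n, i < j → k.val = j.val + 1 → π j < π i ∨ π k < π i

theorem avoids_iff_adjMin {n : ℕ} (π : Equiv.Perm (Fin n)) :
    Avoids π a_bc ∧ Avoids π a_cb ↔ AdjMin π := by
  constructor
  · rintro ⟨h₁, h₂⟩ i j k hij hk
    by_contra! h
    obtain ⟨hj, hk'⟩ := h
    have hjk : j < k := Fin.lt_def.2 (by omega)
    have hik : i < k := hij.trans hjk
    have hj' := lt_of_le_of_ne hj (π.injective.ne hij.ne)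
    have hk'' := lt_of_le_of_ne hk' (π.injective.ne hik.ne)
    rcases lt_or_gt_of_ne (π.injective.ne hjk.ne) with hlt | hlt
    · refine h₁ ![i, j, k] ⟨?_, ?_, ?_⟩ <;> intro a b <;> fin_cases a <;> fin_cases b <;>
        simp [a_bc, *, hj'.le, hk''.le, hlt.le]
    · refine h₂ ![i, j, k] ⟨?_, ?_, ?_⟩ <;> intro a b <;> fin_cases a <;> fin_cases b <;>
        simp [a_cb, *, hj'.le, hk''.le, hlt.le]
  · intro h
    constructor
    · rintro e ⟨h₁, h₂, h₃⟩
      have := h (e 0) (e 1) (e 2) (h₁ _ _ (by decide)) (h₃ 1 2 rfl (by simp [a_bc]))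
      rw [h₂, h₂] at this
      simp [a_bc] at this
    · rintro e ⟨h₁, h₂, h₃⟩
      have := h (e 0) (e 1) (e 2) (h₁ _ _ (by decide)) (h₃ 1 2 rfl (by simp [a_cb]))
      rw [h₂, h₂] at this
      simp [a_cb] at this

theorem adjMin_snoc_iff {n : ℕ} (p : Fin (n + 2)) (σ : Equiv.Perm (Fin (n + 1))) :
    AdjMin (snoc p σ) ↔ AdjMin σ ∧ (p = 0 ∨ σ (Fin.last n) = 0) := by
  constructor
  · intro h
    refine ⟨fun i j k hij hk => ?_, ?_⟩
    · simpa using h i.castSucc j.castSucc k.castSucc hij (by simpa using hk)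
    · by_contra! hne
      -- A letter 0 of `σ` before its last place stays 0 when `p ≠ 0`, and neither of the two final
      -- letters is below it.
      have hi : σ.symm 0 < Fin.last n := by
        refine lt_of_le_of_ne (Fin.le_last _) fun he => hne.2 ?_
        rw [← he, Equiv.apply_symm_apply]
      have := h (σ.symm 0).castSucc (Fin.last n).castSucc (Fin.last (n + 1)) hi (by simp)
      simp [Fin.succAbove_ne_zero_zero hne.1] at this
  · rintro ⟨hσ, h⟩ i j k hij hk
    have hj : j ≠ Fin.last _ := fun e => by subst e; have := k.isLt; simp at hk; omega
    obtain ⟨j, rfl⟩ := Fin.exists_castSucc_eq.2 hj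
    have hi : i ≠ Fin.last _ := (hij.trans (Fin.castSucc_lt_last j)).ne
    obtain ⟨i, rfl⟩ := Fin.exists_castSucc_eq.2 hi
    have hij' : i < j := hij
    induction k using Fin.lastCases with
    | cast k => simpa using hσ i j k hij' (by simpa using hk)
    | last =>
      rcases h with rfl | h
      · right; simp
      · left
        have : j = Fin.last n := Fin.ext (by simp at hk; simp; omega)
        subst this
        simp only [snoc_castSucc, Fin.succAbove_lt_succAbove_iff, h]
        exact Fin.pos_of_ne_zero fun e => hij'.ne (σ.injective (e.trans h.symm))

/-- Relabelling by `p.succAbove` is increasing, so earlier descents are unchanged and only the final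
pair is new. -/
theorem des_snoc {n : ℕ} (p : Fin (n + 2)) (σ : Equiv.Perm (Fin (n + 1))) :
    des (snoc p σ) = des σ + if p < p.succAbove (σ (Fin.last n)) then 1 else 0 := by
  classical
  unfold des
  rw [Finset.card_filter, Finset.card_filter, Fin.sum_univ_castSucc, Fin.sum_univ_castSucc,
    Fin.sum_univ_castSucc]
  have h₁ : ∀ i : Fin n, (∃ h : (i.castSucc.castSucc).val + 1 < n + 1 + 1,
      snoc p σ ⟨(i.castSucc.castSucc).val + 1, h⟩ < snoc p σ i.castSucc.castSucc) ↔
      ∃ h : (i.castSucc).val + 1 < n + 1, σ ⟨(i.castSucc).val + 1, h⟩ < σ i.castSucc := by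
    intro i
    have : snoc p σ ⟨i.val + 1, by omega⟩ = p.succAbove (σ ⟨i.val + 1, by omega⟩) :=
      snoc_castSucc p σ ⟨i.val + 1, by omega⟩
    simp [this]
  have h₂ : (∃ h : ((Fin.last n).castSucc).val + 1 < n + 1 + 1,
      snoc p σ ⟨((Fin.last n).castSucc).val + 1, h⟩ < snoc p σ (Fin.last n).castSucc) ↔
      p < p.succAbove (σ (Fin.last n)) := by
    have : snoc p σ ⟨n + 1, by omega⟩ = p := snoc_last p σ
    simp [this]
  simp only [h₁, h₂]
  simp

/-! ### Recurrences for the Eulerian polynomials -/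

open Classical in
/-- The part of the Eulerian polynomial coming from the permutations with last letter `0`. -/
noncomputable def lastZeroPoly (n : ℕ) : ℚ[X] :=
  ∑ σ : Equiv.Perm (Fin (n + 1)), if AdjMin σ ∧ σ (Fin.last n) = 0 then X ^ (1 + des σ) else 0

open Classical in
theorem eulerianPoly_succ_eq_sum (n : ℕ) :
    eulerianPoly (n + 1) =
      ∑ σ : Equiv.Perm (Fin (n + 1)), if AdjMin σ then X ^ (1 + des σ) else 0 := by
  simp only [eulerianPoly, avoiders, avoids_iff_adjMin]
  rw [if_neg (Nat.succ_ne_zero n), Finset.sum_filter]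

theorem eulerianPoly_zero : eulerianPoly 0 = 1 := by simp [eulerianPoly]

theorem sum_perm_succ {M : Type*} [AddCommMonoid M] (n : ℕ)
    (f : Equiv.Perm (Fin (n + 1)) → M) :
    ∑ π, f π = ∑ p : Fin (n + 1), ∑ σ : Equiv.Perm (Fin n), f (snoc p σ) := by
  rw [← Fintype.sum_prod_type']
  exact ((snoc_bijective n).sum_comp f).symm

theorem adjMin_of_subsingleton (σ : Equiv.Perm (Fin 1)) : AdjMin σ :=
  fun i j _ hij => absurd hij (by simp [Subsingleton.elim i j])

theorem des_of_subsingleton (σ : Equiv.Perm (Fin 1)) : des σ = 0 := by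
  rw [des, Finset.card_eq_zero, Finset.filter_eq_empty_iff]
  rintro i - ⟨h, -⟩
  omega

theorem eulerianPoly_one : eulerianPoly 1 = X := by
  simp [eulerianPoly_succ_eq_sum, adjMin_of_subsingleton, des_of_subsingleton]

/-- A final 0 may follow any avoider, and creates one descent unless it is the only letter; the
convention A_0 = 1 covers that case. -/
theorem lastZeroPoly_eq (n : ℕ) : lastZeroPoly n = X * eulerianPoly n := by
  classical
  cases n with
  | zero =>
    simp [lastZeroPoly, adjMin_of_subsingleton, des_of_subsingleton, eulerianPoly_zero,
      eq_iff_true_of_subsingleton]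
  | succ n =>
    rw [lastZeroPoly, sum_perm_succ, eulerianPoly_succ_eq_sum, Fin.sum_univ_succ,
      Finset.mul_sum]
    simp only [snoc_last, Fin.succ_ne_zero, and_false, if_false, Finset.sum_const_zero, add_zero,
      adjMin_snoc_iff, true_or, and_true, des_snoc]
    refine Finset.sum_congr rfl fun σ _ => ?_
    split_ifs with h h'
    · ring
    · simp at h'
    · simp

theorem eulerianPoly_add_two (n : ℕ) :
    eulerianPoly (n + 2) = X * eulerianPoly (n + 1) + ((n : ℚ[X]) + 1) * (X * eulerianPoly n) := by
  classical
  rw [← lastZeroPoly_eq, ← lastZeroPoly_eq, eulerianPoly_succ_eq_sum, lastZeroPoly,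
    sum_perm_succ, sum_perm_succ (n + 1), Fin.sum_univ_succ, Fin.sum_univ_succ (n := n + 1)]
  simp only [snoc_last, Fin.succ_ne_zero, and_false, if_false, Finset.sum_const_zero, add_zero,
    adjMin_snoc_iff, true_or, and_true, false_or]
  congr 1
  have : ∀ p : Fin (n + 1), (∑ σ : Equiv.Perm (Fin (n + 1)),
      if AdjMin σ ∧ σ (Fin.last n) = 0 then (X : ℚ[X]) ^ (1 + des (snoc p.succ σ)) else 0) =
      lastZeroPoly n := by
    intro p
    refine Finset.sum_congr rfl fun σ _ => ?_
    split_ifs with h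
    -- The penultimate letter 0 is still 0 after relabelling, so the final pair is an ascent.
    · rw [des_snoc, h.2]
      simp [Fin.succAbove_ne_zero_zero (Fin.succ_ne_zero p)]
    · rfl
  simp [this]

/-- Substituted for the derivative term, this turns the differential recurrence into
`eulerianPoly_add_two`. -/
theorem two_mul_X_mul_derivative_eulerianPoly (n : ℕ) :
    2 * X * derivative (eulerianPoly n) = eulerianPoly (n + 1) + ((n : ℚ[X]) - X) * eulerianPoly n := by
  induction n using Nat.twoStepInduction with
  | zero => simp [eulerianPoly_zero, eulerianPoly_one]
  | one => simp [eulerianPoly_add_two, eulerianPoly_zero, eulerianPoly_one]; ring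
  | more n h₀ h₁ =>
    have h₂ := eulerianPoly_add_two n
    have h₃ := eulerianPoly_add_two (n + 1)
    have hd := congrArg derivative h₂
    simp only [derivative_add, derivative_mul, derivative_X, derivative_natCast, derivative_one]
      at hd
    rw [h₃, hd]
    push_cast at h₁ ⊢
    linear_combination X * h₁ + (n + 1) * X * h₀ + (X - n - 2) * h₂

theorem eulerianPoly_add_two_eq_derivative (n : ℕ) :
    eulerianPoly (n + 2) = X * (eulerianPoly n + X * eulerianPoly n +
      2 * X * derivative (eulerianPoly n)) := by
  rw [two_mul_X_mul_derivative_eulerianPoly, eulerianPoly_add_two]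
  ring

/-! ### The explicit formula -/

/-- The number of involutions of `n` points with `k` two-cycles. -/
def pairingCoeff (n k : ℕ) : ℚ :=
  (n.choose k : ℚ) * ((n - k).choose k : ℚ) * ((k.factorial : ℚ) / 2 ^ k)

theorem pairingCoeff_of_lt {n k : ℕ} (h : n < 2 * k) : pairingCoeff n k = 0 := by
  simp [pairingCoeff, Nat.choose_eq_zero_of_lt (show n - k < k by omega)]

theorem pairingCoeff_add (k r : ℕ) :
    pairingCoeff (2 * k + r) k = (2 * k + r).factorial / (k.factorial * r.factorial * 2 ^ k) := by
  rw [pairingCoeff, show 2 * k + r - k = k + r by omega, Nat.cast_choose ℚ (by omega),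
    Nat.cast_choose ℚ (by omega), show 2 * k + r - k = k + r by omega, Nat.add_sub_cancel_left]
  field_simp

theorem pairingCoeff_zero_right (n : ℕ) : pairingCoeff n 0 = 1 := by simp [pairingCoeff]

/-- In an involution, the last point is fixed or is paired with one of the n+1 others; the proof
computes with factorials. -/
theorem pairingCoeff_succ_succ (n k : ℕ) :
    pairingCoeff (n + 2) (k + 1) = pairingCoeff (n + 1) (k + 1) + (n + 1) * pairingCoeff n k := by
  have hf : ∀ m : ℕ, (m.factorial : ℚ) ≠ 0 := fun m => by exact_mod_cast Nat.factorial_ne_zero m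
  rcases lt_or_ge n (2 * k) with h | h
  · simp [pairingCoeff_of_lt h, pairingCoeff_of_lt (show n + 2 < 2 * (k + 1) by omega),
      pairingCoeff_of_lt (show n + 1 < 2 * (k + 1) by omega)]
  obtain ⟨r, rfl⟩ := Nat.exists_eq_add_of_le h
  rw [pairingCoeff_add, show 2 * k + r + 2 = 2 * (k + 1) + r by ring, pairingCoeff_add]
  cases r with
  | zero =>
    -- With r = 0 every point is paired, so the fixed-point term vanishes.
    rw [pairingCoeff_of_lt (by omega), show 2 * (k + 1) + 0 = 2 * k + 0 + 1 + 1 by ring]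
    have := hf k
    simp only [Nat.factorial_succ, Nat.factorial_zero]
    push_cast
    field_simp
    ring
  | succ r =>
    rw [show 2 * k + (r + 1) + 1 = 2 * (k + 1) + r by ring, pairingCoeff_add,
      show 2 * (k + 1) + (r + 1) = 2 * k + r + 1 + 1 + 1 by ring,
      show 2 * (k + 1) + r = 2 * k + r + 1 + 1 by ring,
      show 2 * k + (r + 1) = 2 * k + r + 1 by ring]
    have := hf k
    have := hf r
    simp only [Nat.factorial_succ]
    push_cast
    field_simp
    ring

theorem eulerianPoly_eq_sum_pairingCoeff (n : ℕ) :
    eulerianPoly n = ∑ k ∈ Finset.range (n + 1), C (pairingCoeff n k) * X ^ (n - k) := by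
  induction n using Nat.twoStepInduction with
  | zero => simp [eulerianPoly_zero, pairingCoeff]
  | one => simp [eulerianPoly_one, Finset.sum_range_succ, pairingCoeff]
  | more n h₀ h₁ =>
    have e₁ : X * eulerianPoly (n + 1) = X ^ (n + 2) +
        ∑ k ∈ Finset.range (n + 2), C (pairingCoeff (n + 1) (k + 1)) * X ^ (n + 1 - k) := by
      rw [h₁, Finset.sum_range_succ', Finset.sum_range_succ _ (n + 1), mul_add, Finset.mul_sum,
        pairingCoeff_of_lt (show n + 1 < 2 * (n + 1 + 1) by omega), pairingCoeff_zero_right, add_comm]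
      congr 1
      · simp; ring
      · simp only [map_zero, zero_mul, add_zero]
        refine Finset.sum_congr rfl fun k hk => ?_
        have : n + 1 - k = n + 1 - (k + 1) + 1 := by have := Finset.mem_range.1 hk; omega
        rw [this, pow_succ]
        ring
    have e₀ : X * eulerianPoly n =
        ∑ k ∈ Finset.range (n + 2), C (pairingCoeff n k) * X ^ (n + 1 - k) := by
      rw [h₀, Finset.sum_range_succ _ (n + 1), Finset.mul_sum,
        pairingCoeff_of_lt (show n < 2 * (n + 1) by omega)]
      simp only [map_zero, zero_mul, add_zero]
      refine Finset.sum_congr rfl fun k hk => ?_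
      have : n + 1 - k = n - k + 1 := by have := Finset.mem_range.1 hk; omega
      rw [this, pow_succ]
      ring
    rw [eulerianPoly_add_two, e₁, e₀, Finset.sum_range_succ' _ (n + 2), pairingCoeff_zero_right,
      Finset.mul_sum, add_assoc, ← Finset.sum_add_distrib, add_comm (X ^ (n + 2))]
    congr 1
    · refine Finset.sum_congr rfl fun k _ => ?_
      rw [pairingCoeff_succ_succ, show n + 2 - (k + 1) = n + 1 - k by omega]
      simp only [map_add, map_mul, map_natCast, map_one]
      ring
    · simp

/-! ### The Bessel generating function -/

/-- Only k = m - n contributes, and the kth coefficient of y_n is by definition `pairingCoeff (n +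
k) k`. -/
theorem coeff_aeval_besselPoly_mul (n m : ℕ) :
    PowerSeries.coeff m (aeval (PowerSeries.X : PowerSeries ℚ[X]) (besselPoly n) *
      (PowerSeries.X * PowerSeries.C (X : ℚ[X])) ^ n) =
      if n ≤ m then C (pairingCoeff m (m - n)) * X ^ n else 0 := by
  have hterm : ∀ a : ℚ, ∀ k : ℕ,
      PowerSeries.coeff m (aeval (PowerSeries.X : PowerSeries ℚ[X]) (C a * X ^ k) *
        (PowerSeries.X * PowerSeries.C (X : ℚ[X])) ^ n) =
      if m = k + n then C a * X ^ n else 0 := by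
    intro a k
    have : aeval (PowerSeries.X : PowerSeries ℚ[X]) (C a * X ^ k) *
        (PowerSeries.X * PowerSeries.C (X : ℚ[X])) ^ n =
        PowerSeries.C (C a * X ^ n) * PowerSeries.X ^ (k + n) := by
      rw [map_mul, map_pow, aeval_C, aeval_X, PowerSeries.algebraMap_apply, algebraMap_eq,
        map_mul, map_pow, mul_pow]
      ring
    rw [this, PowerSeries.coeff_C_mul, PowerSeries.coeff_X_pow, mul_ite, mul_one, mul_zero]
  simp only [besselPoly, map_sum, Finset.sum_mul, hterm]
  split_ifs with h
  · obtain ⟨k, rfl⟩ := Nat.exists_eq_add_of_le h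
    have hk : ∀ j, n + k = j + n ↔ k = j := fun j => by omega
    simp only [hk, Finset.sum_ite_eq, Nat.add_sub_cancel_left, pairingCoeff, Nat.add_sub_cancel]
    split_ifs with hmem
    · rfl
    -- Here k exceeds n, the last index in y_n, and the binomial coefficient vanishes too.
    · rw [Nat.choose_eq_zero_of_lt (n := n) (by simpa using hmem)]
      simp
  · exact Finset.sum_eq_zero fun k _ => if_neg (by omega)

theorem formalHasSum_eulerianPoly :
    FormalHasSum (fun n => PowerSeries.C (eulerianPoly n) * PowerSeries.X ^ n)
      (PowerSeries.mk eulerianPoly) := by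
  let _ : TopologicalSpace ℚ[X] := ⊥
  refine (PowerSeries.WithPiTopology.hasSum_iff_hasSum_coeff _).2 fun m => ?_
  convert! hasSum_single (f := fun n => PowerSeries.coeff m
    (PowerSeries.C (eulerianPoly n) * PowerSeries.X ^ n)) m fun n hn => ?_ using 1
  · simp
  · simp [PowerSeries.coeff_X_pow, hn.symm]

theorem formalHasSum_besselPoly :
    FormalHasSum (fun n => aeval (PowerSeries.X : PowerSeries ℚ[X]) (besselPoly n) *
        (PowerSeries.X * PowerSeries.C (X : ℚ[X])) ^ n)
      (PowerSeries.mk eulerianPoly) := by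
  let _ : TopologicalSpace ℚ[X] := ⊥
  refine (PowerSeries.WithPiTopology.hasSum_iff_hasSum_coeff _).2 fun m => ?_
  simp only [coeff_aeval_besselPoly_mul, PowerSeries.coeff_mk]
  rw [eulerianPoly_eq_sum_pairingCoeff, ← Finset.sum_range_reflect]
  convert! hasSum_sum_of_ne_finset_zero (f := fun n => if n ≤ m then
    C (pairingCoeff m (m - n)) * (X : ℚ[X]) ^ n else 0) (s := Finset.range (m + 1))
    fun n hn => ?_ using 1
  · refine Finset.sum_congr rfl fun k hk => ?_
    have hk' : k ≤ m := Nat.lt_succ_iff.1 (Finset.mem_range.1 hk)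
    rw [if_pos hk', show m + 1 - 1 - k = m - k by omega, Nat.sub_sub_self hk']
  · exact if_neg (by simpa using hn)
  · infer_instance

end PatternAvoidance

/-- In the first two conjuncts, the series live in `ℚ[t]⟦x⟧`: the power series variable
`PowerSeries.X` is `x`, and the polynomial variable `Polynomial.X` of the coefficients is `t`. -/
theorem mainTheorem7 :
    -- `∑ A_n(t) x^n = ∑ y_n(x) (x t)^n`: both sums converge, to the same series
    (PatternAvoidance.FormalHasSum
        (fun n => PowerSeries.C (PatternAvoidance.eulerianPoly n) * PowerSeries.X ^ n)
        (PowerSeries.mk PatternAvoidance.eulerianPoly) ∧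
      PatternAvoidance.FormalHasSum
        (fun n => Polynomial.aeval (PowerSeries.X : PowerSeries (Polynomial ℚ))
            (PatternAvoidance.besselPoly n) *
          (PowerSeries.X * PowerSeries.C (Polynomial.X : Polynomial ℚ)) ^ n)
        (PowerSeries.mk PatternAvoidance.eulerianPoly)) ∧
    -- initial values and recurrence
    (PatternAvoidance.eulerianPoly 0 = 1 ∧
      PatternAvoidance.eulerianPoly 1 = Polynomial.X ∧
      ∀ n : ℕ, PatternAvoidance.eulerianPoly (n + 2) =
        Polynomial.X * (PatternAvoidance.eulerianPoly n +
          Polynomial.X * PatternAvoidance.eulerianPoly n +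
          2 * Polynomial.X * Polynomial.derivative (PatternAvoidance.eulerianPoly n))) ∧
    -- explicit formula
    (∀ n : ℕ, PatternAvoidance.eulerianPoly n =
      ∑ k ∈ Finset.range (n + 1),
        Polynomial.C ((n.choose k : ℚ) * ((n - k).choose k : ℚ) * ((k.factorial : ℚ) / 2 ^ k)) *
          Polynomial.X ^ (n - k)) := by
  exact ⟨⟨PatternAvoidance.formalHasSum_eulerianPoly, PatternAvoidance.formalHasSum_besselPoly⟩,
    ⟨PatternAvoidance.eulerianPoly_zero, PatternAvoidance.eulerianPoly_one,
      PatternAvoidance.eulerianPoly_add_two_eq_derivative⟩,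
    PatternAvoidance.eulerianPoly_eq_sum_pairingCoeff⟩
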